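/- Let $G$ be a finite simple graph with $n$ vertices and $m$ edges that is $d$-degenerate, i.e. its vertices can be ordered $v_1,\dots,v_n$ so that each $v_i$ is adjacent to at most $d$ vertices $v_j$ with $j>i$. Let $p$ be a prime dividing $m$ such that $2d<p$ and $2d(d+1)^2\,p\le m$ (for $d\ge 1$ this says $p\le m/(2d(d+1)^2)$). For an abelian group $\Gamma$, let the zero-sum Ramsey number $R(G,\Gamma)$ be the least $\ell\in\mathbb{N}$ such that for every edge-colouring $c:E(K_\ell)\to\Gamma$ there is an injection $f:V(G)\to V(K_\ell)$ with $\sum_{xy\in E(G)}c(f(x)f(y))=0$ (and $R(G,\Gamma)=\infty$ if there is no such $\ell$). Then $$R(G,\mathbb{Z}_p)\le n+(3+3d)p,$$ and every edge-colouring $c:E(K_\ell)\to\mathbb{Z}_p$ with $\ell=n+(3+3d)p$ has an injection $f:V(G)\to V(K_\ell)$ with $\sum_{xy\in E(G)}c(f(x)f(y))=0$. -/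

import Mathlib

namespace ZeroSumRamsey

/-- A finite graph `G` is `d`-degenerate if its vertices can be listed as `v₀, …, vₙ₋₁` so that
every `vᵢ` is adjacent to at most `d` vertices that come later in the list. -/
def IsDegenerate {V : Type*} [Fintype V] (G : SimpleGraph V) (d : ℕ) : Prop :=
  ∃ v : Fin (Fintype.card V) ≃ V,
    ∀ i, Set.ncard {j : Fin (Fintype.card V) | i < j ∧ G.Adj (v i) (v j)} ≤ d

/-- A copy `f` of `G` in the complete graph on `W` is zero-sum for the edge-colouring `c` of that
complete graph if the colours of the images of the edges of `G` add up to `0`. -/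
def IsZeroSum {V W Γ : Type*} [AddCommGroup Γ] (G : SimpleGraph V) [Fintype G.edgeSet]
    (c : SimpleGraph.TopEdgeLabeling W Γ) (f : SimpleGraph.Copy G (⊤ : SimpleGraph W)) : Prop :=
  ∑ e : G.edgeSet, c (f.toHom.mapEdgeSet e) = 0

/-- Every `Γ`-colouring of the edges of the complete graph `K_ℓ` has a zero-sum copy of `G`. -/
def Arrows {V : Type*} (G : SimpleGraph V) [Fintype G.edgeSet] (Γ : Type*) [AddCommGroup Γ]
    (ℓ : ℕ) : Prop :=
  ∀ c : SimpleGraph.TopEdgeLabeling (Fin ℓ) Γ,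
    ∃ f : SimpleGraph.Copy G (⊤ : SimpleGraph (Fin ℓ)), IsZeroSum G c f

/-- The zero-sum Ramsey number `R(G, Γ)`: the least `ℓ` such that every `Γ`-colouring of the
edges of `K_ℓ` has a zero-sum copy of `G`. It is `⊤` if there is no such `ℓ`. -/
noncomputable def ramseyNumber {V : Type*} (G : SimpleGraph V) [Fintype G.edgeSet]
    (Γ : Type*) [AddCommGroup Γ] : ℕ∞ :=
  ⨅ (ℓ : ℕ) (_ : Arrows G Γ ℓ), (ℓ : ℕ∞)

end ZeroSumRamsey

/-!
Write `n` and `m` for the numbers of vertices and edges of `G`, and let `d ≥ 1`.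

*Switches.* Suppose that a copy of `G` is given together with pairwise non-adjacent vertices
`v₁, …, vₚ₋₁` of `G` and unused alternative places for them, such that moving any one `vᵢ` to its
alternative place changes the colour sum. The moves act independently, so by the Cauchy–Davenport
theorem some combination of them makes the sum zero (`HasSwitches.exists_sum_eq_zero`). If there is
instead a large set of vertices in which every vertex has few edges of a colour other than `α`, then
`G`, being degenerate, embeds greedily with all edges of colour `α`, and the sum `m α` vanishes as
`p ∣ m` (`IsDegenerate.exists_mono_of_isNearlyMono`). The proof shows that one of the two happens.

*The vertices to be switched.* The Caro–Wei bound and the inequality `(2d + 1 - x)(1 + x) ≤ (d + 1)²`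
give an independent set `I` of at least `m / (d (d + 1)²) ≥ 2p` vertices whose degrees are between
`1` and `2d < p` (`IsDegenerate.exists_indep`).

*Hubs.* The difficulty is that the vertices of `I` can share neighbours. Take a hub `t`, a vertex
with `s ≥ 1` neighbours in `I`, and two options `a`, `b` for its place. If the rows of `a` and `b`
in the colouring differ by a function that separates `s` disjoint pairs of vertices, offer these
pairs to the neighbours of `t` in `I`: for each of them, one of the options `a`, `b` makes its pair
a switch, wherever the other vertices go. So half of these neighbours become switches
(`HasSwitches.extend`), and the argument continues with the vertices of `I` not adjacent to `t`.
With `s` odd (for `s` even one neighbour is left out), every switch costs at most `4` vertices of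
the host and at most `2` vertices of `I`, which is why `2p` vertices of `I` suffice.

*No more hubs.* If this stops with `k` switches still wanted, then any two rows differ by a constant
off at most `2k - 2` places, and these constants are differences `h a - h b`
(`exists_potential`). If `h` separates `2k` disjoint pairs, a random placement of the rest of `G`
avoids the exceptional places of at least half of the pairs, and these are switches because
`deg v * (h (x v) - h (y v)) ≠ 0` modulo `p` (`hasSwitches_of_rows_ne`). Otherwise `h` is constant off fewer
than `2k` vertices, so that any two of the other rows nearly agree; by averaging and the symmetry of
the colouring, some row is nearly constant, hence all are
(`exists_isNearlyMono_of_rows_agree`). The exceptional vertices and degrees met on the way fit into the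
`(3 + 3d) p` spare vertices.
-/

namespace ZeroSumRamsey

open Finset

section Auxiliary

open scoped Classical Pointwise

/-! ### Independent sets of low degree in degenerate graphs -/

/-- Each edge is counted at its earlier endpoint in a degeneracy order; isolated vertices count
nothing. -/
lemma IsDegenerate.card_edgeFinset_le {V : Type*} [Fintype V] {G : SimpleGraph V} {d : ℕ}
    (hG : IsDegenerate G d) : #G.edgeFinset ≤ d * #{v | G.degree v ≠ 0} := by
  obtain ⟨v, hv⟩ := hG
  have hdeg (i) : G.degree (v i) =
      #{j | i < j ∧ G.Adj (v i) (v j)} + #{j | j < i ∧ G.Adj (v j) (v i)} := by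
    rw [← G.card_neighborFinset_eq_degree, ← card_union_of_disjoint]
    · refine (card_bij (fun j _ ↦ v j) ?_ (fun _ _ _ _ h ↦ v.injective h) ?_).symm
      · intro j hj
        simp only [mem_union, mem_filter, mem_univ, true_and] at hj
        rw [G.mem_neighborFinset]
        exact hj.elim (fun h ↦ h.2) fun h ↦ h.2.symm
      · intro w hw
        rw [G.mem_neighborFinset] at hw
        refine ⟨v.symm w, ?_, v.apply_symm_apply w⟩
        have hne : i ≠ v.symm w := by
          rintro rfl
          simp at hw
        simp only [mem_union, mem_filter, mem_univ, true_and, v.apply_symm_apply]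
        exact (lt_or_gt_of_ne hne).imp (fun h ↦ ⟨h, hw⟩) fun h ↦ ⟨h, hw.symm⟩
    · rw [disjoint_filter]
      exact fun j _ h h' ↦ (h.1.trans h'.1).false
  have hswap : ∑ i, #{j | j < i ∧ G.Adj (v j) (v i)} = ∑ i, #{j | i < j ∧ G.Adj (v i) (v j)} := by
    simp only [card_filter]
    exact sum_comm
  have htwo : ∑ i, G.degree (v i) = 2 * ∑ i, #{j | i < j ∧ G.Adj (v i) (v j)} := by
    simp only [hdeg, sum_add_distrib, hswap, two_mul]
  rw [v.sum_comp (fun w ↦ G.degree w), G.sum_degrees_eq_twice_card_edges] at htwo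
  have hle : ∀ i, #{j | i < j ∧ G.Adj (v i) (v j)} ≤ if G.degree (v i) ≠ 0 then d else 0 := by
    intro i
    split_ifs with h
    · refine le_trans (le_of_eq ?_) (hv i)
      rw [← Set.ncard_coe_finset]
      simp
    · have := hdeg i
      omega
  calc #G.edgeFinset = ∑ i, #{j | i < j ∧ G.Adj (v i) (v j)} := by omega
    _ ≤ ∑ i, if G.degree (v i) ≠ 0 then d else 0 := sum_le_sum fun i _ ↦ hle i
    _ = ∑ w, if G.degree w ≠ 0 then d else 0 :=
        v.sum_comp (fun w ↦ if G.degree w ≠ 0 then d else 0)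
    _ = d * #{w | G.degree w ≠ 0} := by
        rw [← sum_filter, sum_const, smul_eq_mul, mul_comm]

/-- The Caro–Wei bound for a set `L` of vertices, in the weak form with the degrees taken in the
whole graph. A vertex of least degree pays for its closed neighbourhood. -/
lemma exists_indep_sum_le_card {V : Type*} [Fintype V] (G : SimpleGraph V) (L : Finset V) :
    ∃ I ⊆ L, (∀ u ∈ I, ∀ v ∈ I, ¬ G.Adj u v) ∧ ∑ v ∈ L, (1 / (1 + G.degree v) : ℚ) ≤ #I := by
  induction L using Finset.strongInduction with
  | H L ih =>
    rcases L.eq_empty_or_nonempty with rfl | hL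
    · exact ⟨∅, by simp⟩
    obtain ⟨v, hvL, hv⟩ := exists_min_image L (fun v ↦ G.degree v) hL
    let N := insert v (G.neighborFinset v)
    obtain ⟨I, hIL, hI, hsum⟩ := ih (L \ N) (by
      refine (ssubset_iff_of_subset sdiff_subset).2 ⟨v, hvL, ?_⟩
      simp [N])
    have hvI (u) (hu : u ∈ I) : u ≠ v ∧ ¬ G.Adj v u := by
      have := hIL hu
      simp only [N, mem_sdiff, mem_insert, G.mem_neighborFinset, not_or] at this
      exact this.2
    refine ⟨insert v I, insert_subset hvL (hIL.trans sdiff_subset), ?_, ?_⟩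
    · intro u hu w hw
      rw [mem_insert] at hu hw
      rcases hu with rfl | hu <;> rcases hw with rfl | hw
      · simp
      · exact (hvI w hw).2
      · exact fun h ↦ (hvI u hu).2 h.symm
      · exact hI u hu w hw
    · rw [card_insert_of_notMem fun h ↦ (hvI v h).1 rfl, ← sum_inter_add_sum_sdiff L N]
      have hpos : (0 : ℚ) < 1 + G.degree v := by positivity
      have hN : #(L ∩ N) ≤ 1 + G.degree v := by
        refine (card_le_card inter_subset_right).trans ((card_insert_le _ _).trans ?_)
        rw [G.card_neighborFinset_eq_degree, add_comm]
      have : ∑ w ∈ L ∩ N, (1 / (1 + G.degree w) : ℚ) ≤ 1 := by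
        calc ∑ w ∈ L ∩ N, (1 / (1 + G.degree w) : ℚ)
            ≤ ∑ w ∈ L ∩ N, (1 / (1 + G.degree v) : ℚ) := by
              refine sum_le_sum fun w hw ↦ one_div_le_one_div_of_le hpos ?_
              have := hv w (mem_inter.1 hw).1
              gcongr
          _ = #(L ∩ N) / (1 + G.degree v) := by rw [sum_const, nsmul_eq_mul, mul_one_div]
          _ ≤ 1 := by
              rw [div_le_one hpos]
              exact_mod_cast hN
      push_cast
      linarith

/-- A `d`-degenerate graph with `m` edges has an independent set of at least `m / (d (d + 1)²)`
vertices whose degrees lie between `1` and `2d`. -/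
lemma IsDegenerate.exists_indep {V : Type*} [Fintype V] {G : SimpleGraph V} {d : ℕ}
    (hG : IsDegenerate G d) :
    ∃ I : Finset V, (∀ u ∈ I, ∀ v ∈ I, ¬ G.Adj u v) ∧
      (∀ v ∈ I, 1 ≤ G.degree v ∧ G.degree v ≤ 2 * d) ∧
      #G.edgeFinset ≤ d * (d + 1) ^ 2 * #I := by
  let A : Finset V := {v | G.degree v ≠ 0}
  let L : Finset V := {v ∈ A | G.degree v ≤ 2 * d}
  obtain ⟨I, hIL, hI, hsum⟩ := exists_indep_sum_le_card G L
  refine ⟨I, hI, fun v hv ↦ ?_, ?_⟩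
  · have := hIL hv
    simp only [L, A, mem_filter, mem_univ, true_and] at this
    omega
  have hm := hG.card_edgeFinset_le
  have htwo : (∑ v ∈ A, G.degree v : ℕ) = 2 * #G.edgeFinset := by
    rw [← G.sum_degrees_eq_twice_card_edges]
    exact sum_filter_ne_zero univ
  -- The numbers `2d + 1 - deg v` add up to at least the number of non-isolated vertices, and the
  -- vertices of degree more than `2d` contribute nothing positive.
  have hA : (#A : ℚ) ≤ ∑ v ∈ A, (2 * d + 1 - G.degree v : ℚ) := by
    rw [sum_sub_distrib, sum_const, nsmul_eq_mul]
    have h1 : (∑ v ∈ A, (G.degree v : ℚ)) = 2 * #G.edgeFinset := by exact_mod_cast htwo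
    have h2 : (#G.edgeFinset : ℚ) ≤ d * #A := by exact_mod_cast hm
    rw [h1]
    linarith
  have hL : ∑ v ∈ A, (2 * d + 1 - G.degree v : ℚ) ≤
      ∑ v ∈ L, ((d + 1) ^ 2 * (1 / (1 + G.degree v)) : ℚ) := by
    rw [show L = A.filter (fun v ↦ G.degree v ≤ 2 * d) from rfl, sum_filter (s := A)]
    refine sum_le_sum fun v _ ↦ ?_
    split_ifs with h
    · rw [mul_one_div, le_div_iff₀ (by positivity)]
      nlinarith [sq_nonneg ((d : ℚ) - G.degree v)]
    · have : (2 * d + 1 : ℚ) ≤ G.degree v := by exact_mod_cast (not_le.1 h)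
      linarith
  rw [← mul_sum] at hL
  have h3 : (#A : ℚ) ≤ (d + 1) ^ 2 * #I :=
    (hA.trans hL).trans (mul_le_mul_of_nonneg_left hsum (by positivity))
  have h4 : #A ≤ (d + 1) ^ 2 * #I := by exact_mod_cast h3
  calc #G.edgeFinset ≤ d * #A := hm
    _ ≤ d * ((d + 1) ^ 2 * #I) := Nat.mul_le_mul_left d h4
    _ = d * (d + 1) ^ 2 * #I := by ring

/-! ### Nearly monochromatic sets of vertices -/

/-- Every vertex of `R` has at most `D` edges inside `R` whose colour is not `a`. -/
def IsNearlyMono {W Γ : Type*} [DecidableEq Γ] (C : Sym2 W → Γ) (a : Γ) (D : ℕ)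
    (R : Finset W) : Prop :=
  ∀ x ∈ R, #{y ∈ R | y ≠ x ∧ C s(x, y) ≠ a} ≤ D

/-- A nearly monochromatic set with `d * D` spare vertices has a monochromatic copy of a
`d`-degenerate graph: embed the vertices in the reverse of a degeneracy order, so that each has at
most `d` embedded neighbours, each of which forbids at most `D` places. -/
lemma IsDegenerate.exists_mono_of_isNearlyMono {V W Γ : Type*} [Fintype V] [DecidableEq Γ]
    {G : SimpleGraph V} {d D : ℕ} (hG : IsDegenerate G d) {C : Sym2 W → Γ} {a : Γ} {R : Finset W}
    (hR : IsNearlyMono C a D R) (hcard : Fintype.card V + d * D ≤ #R) :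
    ∃ φ : V → W, Function.Injective φ ∧ ∀ u v, G.Adj u v → C s(φ u, φ v) = a := by
  rcases isEmpty_or_nonempty V with hV | hV
  · exact ⟨fun v ↦ isEmptyElim v, fun v ↦ isEmptyElim v, fun v ↦ isEmptyElim v⟩
  have hn0 : 0 < Fintype.card V := Fintype.card_pos
  unfold IsDegenerate at hG
  generalize Fintype.card V = n at hG hcard hn0
  obtain ⟨v, hv⟩ := hG
  have key : ∀ k ≤ n, ∃ f : Fin n → W, (∀ i : Fin n, n ≤ i + k → f i ∈ R) ∧
      (∀ i j : Fin n, n ≤ i + k → i < j → f i ≠ f j) ∧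
      ∀ i j : Fin n, n ≤ i + k → i < j → G.Adj (v i) (v j) → C s(f i, f j) = a := by
    intro k
    induction k with
    | zero =>
      intro _
      obtain ⟨x, -⟩ : R.Nonempty := card_pos.1 (by omega)
      refine ⟨fun _ ↦ x, fun i hi ↦ ?_, fun i _ hi ↦ ?_, fun i _ hi ↦ ?_⟩ <;>
        exact absurd i.2 (by omega)
    | succ k ih =>
      intro hk
      obtain ⟨f, hfR, hfinj, hfC⟩ := ih (by omega)
      let i₀ : Fin n := ⟨n - k - 1, by omega⟩
      have hi₀ : (i₀ : ℕ) = n - k - 1 := rfl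
      let U : Finset W := (univ.erase i₀).image f
      let F : Finset (Fin n) := {j | i₀ < j ∧ G.Adj (v i₀) (v j)}
      let B : Finset W := F.biUnion fun j ↦ {y ∈ R | y ≠ f j ∧ C s(f j, y) ≠ a}
      have hU : #U ≤ n - 1 := by
        refine card_image_le.trans ?_
        rw [card_erase_of_mem (mem_univ _), card_univ, Fintype.card_fin]
      have hF : #F ≤ d := by
        refine le_trans (le_of_eq ?_) (hv i₀)
        rw [← Set.ncard_coe_finset]
        simp [F]
      have hB : #B ≤ d * D := by
        refine (card_biUnion_le_card_mul _ _ D fun j hj ↦ hR _ (hfR j ?_)).trans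
          (Nat.mul_le_mul_right D hF)
        have : i₀ < j := (mem_filter.1 hj).2.1
        have : (i₀ : ℕ) < j := this
        omega
      obtain ⟨x, hxR, hx⟩ : ∃ x ∈ R, x ∉ U ∪ B :=
        exists_mem_notMem_of_card_lt_card ((card_union_le U B).trans_lt (by omega))
      rw [mem_union, not_or] at hx
      have hxf (j) (hj : j ≠ i₀) : x ≠ f j := by
        rintro rfl
        exact hx.1 (mem_image_of_mem f (mem_erase.2 ⟨hj, mem_univ j⟩))
      have hcase (i : Fin n) (hi : n ≤ i + (k + 1)) : i = i₀ ∨ (i ≠ i₀ ∧ n ≤ i + k) := by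
        by_cases h : i = i₀
        · exact Or.inl h
        · refine Or.inr ⟨h, ?_⟩
          have : (i : ℕ) ≠ i₀ := fun h' ↦ h (Fin.ext h')
          omega
      have hlt (i j : Fin n) (hi : n ≤ i + k) (hij : i < j) : j ≠ i₀ := by
        have : (i : ℕ) < j := hij
        intro h
        have : (j : ℕ) = i₀ := congrArg _ h
        omega
      refine ⟨Function.update f i₀ x, ?_, ?_, ?_⟩
      · intro i hi
        rcases hcase i hi with rfl | ⟨h, hi⟩
        · simpa using hxR
        · simpa [h] using hfR i hi
      · intro i j hi hij
        rcases hcase i hi with rfl | ⟨h, hi⟩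
        · simpa [hij.ne'] using hxf j hij.ne'
        · simpa [h, hlt i j hi hij] using hfinj i j hi hij
      · intro i j hi hij hadj
        rcases hcase i hi with rfl | ⟨h, hi⟩
        · rw [Function.update_self, Function.update_of_ne hij.ne', Sym2.eq_swap]
          by_contra hne
          exact hx.2 (mem_biUnion.2 ⟨j, mem_filter.2 ⟨mem_univ j, hij, hadj⟩,
            mem_filter.2 ⟨hxR, hxf j hij.ne', hne⟩⟩)
        · simpa [h, hlt i j hi hij] using hfC i j hi hij hadj
  obtain ⟨f, -, hinj, hC⟩ := key n le_rfl
  have hf : Function.Injective f := by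
    intro i j hij
    rcases lt_trichotomy i j with h | h | h
    · exact absurd hij (hinj i j (by omega) h)
    · exact h
    · exact absurd hij.symm (hinj j i (by omega) h)
  refine ⟨f ∘ v.symm, hf.comp v.symm.injective, fun u w huw ↦ ?_⟩
  rcases lt_trichotomy (v.symm u) (v.symm w) with h | h | h
  · exact hC _ _ (by omega) h (by simpa using huw)
  · exact absurd (v.symm.injective h) huw.ne
  · rw [Sym2.eq_swap]
    exact hC _ _ (by omega) h (by simpa using huw.symm)

/-! ### Switches -/

/-- There are an embedding `φ` of the vertices of `G` into `R`, at least `k` vertices `v` in `I`,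
and distinct unused alternative places `y v ∈ R` for them, such that moving `v` alone from `φ v` to
`y v` changes the colour sum of the copy of `G`. -/
def HasSwitches {V W Γ : Type*} [Fintype V] [AddCommGroup Γ] (G : SimpleGraph V) (C : Sym2 W → Γ)
    (k : ℕ) (I : Finset V) (R : Finset W) : Prop :=
  ∃ (φ y : V → W) (J : Finset V), Function.Injective φ ∧ (∀ v, φ v ∈ R) ∧ J ⊆ I ∧ k ≤ #J ∧
    Set.InjOn y J ∧ (∀ v ∈ J, y v ∈ R ∧ ∀ w, φ w ≠ y v) ∧
    ∀ v ∈ J, ∑ w ∈ G.neighborFinset v, (C s(φ w, φ v) - C s(φ w, y v)) ≠ 0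

/-- By the Cauchy–Davenport theorem, the subset sums of `p - 1` nonzero residues modulo `p` are all
residues. -/
lemma exists_subset_sum_eq {V : Type*} {p : ℕ} (hp : p.Prime) (J : Finset V) (δ : V → ZMod p)
    (hδ : ∀ v ∈ J, δ v ≠ 0) (hJ : p - 1 ≤ #J) (t : ZMod p) : ∃ Y ⊆ J, ∑ v ∈ Y, δ v = t := by
  have : Fact p.Prime := ⟨hp⟩
  have key : ∀ J : Finset V, (∀ v ∈ J, δ v ≠ 0) →
      min p (#J + 1) ≤ #(J.powerset.image fun Y ↦ ∑ v ∈ Y, δ v) := by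
    intro J
    induction J using Finset.induction with
    | empty => simp
    | insert v J hv ih =>
      intro hδ
      have ih := ih fun w hw ↦ hδ w (mem_insert_of_mem hw)
      set A := J.powerset.image fun Y ↦ ∑ v ∈ Y, δ v with hA
      have hA0 : A.Nonempty := ⟨0, mem_image.2 ⟨∅, by simp⟩⟩
      have hcd := ZMod.cauchy_davenport hp hA0
        (insert_nonempty (0 : ZMod p) ({δ v} : Finset (ZMod p)))
      rw [card_pair (hδ v (mem_insert_self v J)).symm] at hcd
      have hsub : A + ({0, δ v} : Finset (ZMod p)) ⊆
          (insert v J).powerset.image fun Y ↦ ∑ v ∈ Y, δ v := by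
        intro s hs
        obtain ⟨b, hb, e, he, rfl⟩ := mem_add.1 hs
        obtain ⟨Y, hY, rfl⟩ := mem_image.1 hb
        rw [mem_powerset] at hY
        rw [mem_insert, mem_singleton] at he
        rcases he with rfl | rfl
        · exact mem_image.2 ⟨Y, mem_powerset.2 (hY.trans (subset_insert v J)), by simp⟩
        · refine mem_image.2 ⟨insert v Y, mem_powerset.2 (insert_subset_insert v hY), ?_⟩
          rw [sum_insert fun h ↦ hv (hY h), add_comm]
      have := card_le_card hsub
      rw [card_insert_of_notMem hv]
      omega
  have hle := key J hδ
  have hp0 := hp.pos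
  rw [min_eq_left (by omega)] at hle
  have huniv : (J.powerset.image fun Y ↦ ∑ v ∈ Y, δ v) = univ := by
    rw [← card_eq_iff_eq_univ, ZMod.card]
    exact le_antisymm ((card_le_univ _).trans_eq (ZMod.card p)) hle
  obtain ⟨Y, hY, h⟩ := mem_image.1 (huniv ▸ mem_univ t)
  exact ⟨Y, mem_powerset.1 hY, h⟩

/-- The effect on the colour sum of moving one vertex. -/
lemma sum_edgeFinset_map_update {V W Γ : Type*} [Fintype V] [AddCommGroup Γ] (G : SimpleGraph V)
    (C : Sym2 W → Γ) (φ : V → W) (v : V) (y : W) :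
    ∑ e ∈ G.edgeFinset, C (e.map (Function.update φ v y)) =
      ∑ e ∈ G.edgeFinset, C (e.map φ) -
        ∑ w ∈ G.neighborFinset v, (C s(φ w, φ v) - C s(φ w, y)) := by
  have hinc (g : Sym2 V → Γ) :
      ∑ e ∈ G.edgeFinset with v ∈ e, g e = ∑ w ∈ G.neighborFinset v, g s(w, v) := by
    refine (sum_nbij (fun w ↦ s(w, v)) ?_ ?_ ?_ fun _ _ ↦ rfl).symm
    · intro w hw
      rw [G.mem_neighborFinset] at hw
      simp [hw.symm]
    · intro w _ w' _ h
      rw [Sym2.eq_iff] at h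
      rcases h with h | h
      · exact h.1
      · exact h.1.trans h.2
    · intro e he
      simp only [coe_filter, Set.mem_ofPred_eq, G.mem_edgeFinset] at he
      obtain ⟨w, rfl⟩ := he.2
      refine ⟨w, ?_, Sym2.eq_swap⟩
      simpa using he.1
  have hrest : ∑ e ∈ G.edgeFinset with v ∉ e, C (e.map (Function.update φ v y)) =
      ∑ e ∈ G.edgeFinset with v ∉ e, C (e.map φ) := by
    refine sum_congr rfl fun e he ↦ ?_
    congr 1
    refine Sym2.map_congr fun w hw ↦ Function.update_of_ne ?_ _ _
    rintro rfl
    exact (mem_filter.1 he).2 hw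
  rw [← sum_filter_add_sum_filter_not G.edgeFinset (fun e ↦ v ∈ e),
    ← sum_filter_add_sum_filter_not G.edgeFinset (fun e ↦ v ∈ e) (fun e ↦ C (e.map φ)), hrest,
    hinc, hinc, sum_sub_distrib]
  have : ∀ w ∈ G.neighborFinset v,
      C (Sym2.map (Function.update φ v y) s(w, v)) = C s(φ w, y) := by
    intro w hw
    rw [G.mem_neighborFinset] at hw
    simp [hw.ne']
  rw [sum_congr rfl this]
  simp only [Sym2.map_mk]
  abel

/-- `p - 1` switches at pairwise non-adjacent vertices act independently, so some combination of
them gives a zero-sum copy. -/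
lemma HasSwitches.exists_sum_eq_zero {V W : Type*} [Fintype V] {G : SimpleGraph V} {p : ℕ}
    (hp : p.Prime) {C : Sym2 W → ZMod p} {I : Finset V} {R : Finset W}
    (hI : ∀ u ∈ I, ∀ v ∈ I, ¬ G.Adj u v) (h : HasSwitches G C (p - 1) I R) :
    ∃ φ : V → W, Function.Injective φ ∧ ∑ e ∈ G.edgeFinset, C (e.map φ) = 0 := by
  obtain ⟨φ, y, J, hφ, -, hJI, hJ, hy, hφy, hΔ⟩ := h
  obtain ⟨Y, hYJ, hY⟩ := exists_subset_sum_eq hp J _ hΔ hJ (∑ e ∈ G.edgeFinset, C (e.map φ))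
  have key : ∀ Y ⊆ J, ∑ e ∈ G.edgeFinset, C (e.map fun w ↦ if w ∈ Y then y w else φ w) =
      ∑ e ∈ G.edgeFinset, C (e.map φ) -
        ∑ v ∈ Y, ∑ w ∈ G.neighborFinset v, (C s(φ w, φ v) - C s(φ w, y v)) := by
    intro Y
    induction Y using Finset.induction with
    | empty => simp
    | insert v Y hv ih =>
      intro hYJ
      have hvJ := hYJ (mem_insert_self v Y)
      have hupd : (fun w ↦ if w ∈ insert v Y then y w else φ w) =
          Function.update (fun w ↦ if w ∈ Y then y w else φ w) v (y v) := by
        funext w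
        by_cases hw : w = v
        · subst hw
          simp
        · simp [hw]
      have hN : ∀ w ∈ G.neighborFinset v, w ∉ Y := by
        intro w hw hwY
        rw [G.mem_neighborFinset] at hw
        exact hI v (hJI hvJ) w (hJI (hYJ (mem_insert_of_mem hwY))) hw
      rw [hupd, sum_edgeFinset_map_update, ih ((subset_insert v Y).trans hYJ), sum_insert hv,
        sub_sub, add_comm]
      congr 2
      refine sum_congr rfl fun w hw ↦ ?_
      simp only [hN w hw, hv, if_false]
  refine ⟨fun w ↦ if w ∈ Y then y w else φ w, ?_, by rw [key Y hYJ, hY, sub_self]⟩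
  intro u w huw
  dsimp only at huw
  split_ifs at huw with hu hw hw
  · exact hy (hYJ hu) (hYJ hw) huw
  · exact absurd huw.symm ((hφy u (hYJ hu)).2 w)
  · exact absurd huw ((hφy w (hYJ hw)).2 u)
  · exact hφ huw

/-! ### Disjoint pairs separated by a function -/

/-- The pairs `(x v, y v)`, for `v ∈ J`, consist of `2 * #J` distinct elements of `M`. -/
structure IsDisjointPairs {V W : Type*} (J : Finset V) (M : Finset W) (x y : V → W) : Prop where
  injOn_left : Set.InjOn x J
  injOn_right : Set.InjOn y J
  left_mem : ∀ v ∈ J, x v ∈ M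
  right_mem : ∀ v ∈ J, y v ∈ M
  ne : ∀ u ∈ J, ∀ v ∈ J, x u ≠ y v

lemma IsDisjointPairs.card_union {V W : Type*} {J : Finset V} {M : Finset W} {x y : V → W}
    (h : IsDisjointPairs J M x y) : #(J.image x ∪ J.image y) = 2 * #J := by
  rw [card_union_of_disjoint, card_image_of_injOn h.injOn_left, card_image_of_injOn h.injOn_right,
    two_mul]
  rw [disjoint_left]
  intro a ha hb
  obtain ⟨u, hu, rfl⟩ := mem_image.1 ha
  obtain ⟨v, hv, huv⟩ := mem_image.1 hb
  exact h.ne u hu v hv huv.symm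

lemma IsDisjointPairs.union_subset {V W : Type*} {J : Finset V} {M : Finset W} {x y : V → W}
    (h : IsDisjointPairs J M x y) : J.image x ∪ J.image y ⊆ M :=
  Finset.union_subset (image_subset_iff.2 h.left_mem) (image_subset_iff.2 h.right_mem)

lemma exists_injOn_of_card_le {V W : Type*} [Nonempty W] {J : Finset V} {A : Finset W}
    (h : #J ≤ #A) : ∃ f : V → W, Set.InjOn f J ∧ ∀ v ∈ J, f v ∈ A := by
  obtain ⟨f, hf, hinj⟩ := J.finite_toSet.exists_injOn_of_encard_le (t := (A : Set W)) (by
    simpa using h)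
  exact ⟨f, hinj, fun v hv ↦ hf hv⟩

/-- On a set of at least `3r` elements, a function either separates `r` disjoint pairs or takes a
single value off fewer than `r` elements. -/
lemma exists_isDisjointPairs_or_card_lt {V W β : Type*} [Nonempty W] [DecidableEq β]
    (J : Finset V) (M : Finset W) (h : W → β) (hM : 3 * #J ≤ #M) :
    (∃ x y : V → W, IsDisjointPairs J M x y ∧ ∀ v ∈ J, h (x v) ≠ h (y v)) ∨
      ∃ b, #{a ∈ M | h a ≠ b} < #J := by
  by_cases hbig : ∃ b, #J ≤ #{a ∈ M | h a = b}
  · obtain ⟨b, hb⟩ := hbig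
    rcases lt_or_ge #{a ∈ M | h a ≠ b} #J with hlt | hge
    · exact Or.inr ⟨b, hlt⟩
    obtain ⟨x, hx, hxM⟩ := exists_injOn_of_card_le hb
    obtain ⟨y, hy, hyM⟩ := exists_injOn_of_card_le hge
    simp only [mem_filter] at hxM hyM
    have hne : ∀ u ∈ J, ∀ v ∈ J, h (x u) ≠ h (y v) := fun u hu v hv heq ↦
      (hyM v hv).2 (heq.symm.trans (hxM u hu).2)
    exact Or.inl ⟨x, y, ⟨hx, hy, fun v hv ↦ (hxM v hv).1, fun v hv ↦ (hyM v hv).1,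
      fun u hu v hv heq ↦ hne u hu v hv (congrArg h heq)⟩, fun v hv ↦ hne v hv v hv⟩
  · -- All fibres are smaller than `#J`, so the pairs can be chosen greedily.
    push Not at hbig
    left
    have key : ∀ J' ⊆ J, ∃ x y : V → W, IsDisjointPairs J' M x y ∧
        ∀ v ∈ J', h (x v) ≠ h (y v) := by
      intro J'
      induction J' using Finset.induction with
      | empty =>
        intro _
        have w : W := Classical.arbitrary W
        exact ⟨fun _ ↦ w, fun _ ↦ w, ⟨by simp, by simp, by simp, by simp, by simp⟩, by simp⟩
      | insert v J' hv ih =>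
        intro hJ'
        obtain ⟨x, y, hxy, hne⟩ := ih ((subset_insert v J').trans hJ')
        have hU := hxy.card_union
        set U := J'.image x ∪ J'.image y with hUdef
        have hJ'card : #J' + 1 ≤ #J := by
          rw [← card_insert_of_notMem hv]
          exact card_le_card hJ'
        have hMU : #M ≤ #(M \ U) + 2 * #J' := by
          have := le_card_sdiff U M
          omega
        obtain ⟨a, ha⟩ : (M \ U).Nonempty := card_pos.1 (by omega)
        obtain ⟨b, hb, hab⟩ : ∃ b ∈ M \ U, h b ≠ h a := by
          by_contra! hcon
          have : M \ U ⊆ {c ∈ M | h c = h a} := fun c hc ↦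
            mem_filter.2 ⟨(mem_sdiff.1 hc).1, hcon c hc⟩
          have := card_le_card this
          have := hbig (h a)
          omega
        have hnot {c : W} (hc : c ∈ M \ U) (u : V) (hu : u ∈ J') : x u ≠ c ∧ y u ≠ c := by
          constructor <;> rintro rfl <;> refine (mem_sdiff.1 hc).2 ?_
          · exact mem_union_left _ (mem_image_of_mem x hu)
          · exact mem_union_right _ (mem_image_of_mem y hu)
        have hu_ne {u : V} (hu : u ∈ J') : u ≠ v := fun h ↦ hv (h ▸ hu)
        refine ⟨Function.update x v a, Function.update y v b, ⟨?_, ?_, ?_, ?_, ?_⟩, ?_⟩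
        · intro u hu w hw huw
          rw [mem_coe, mem_insert] at hu hw
          rcases hu with rfl | hu <;> rcases hw with rfl | hw
          · rfl
          · rw [Function.update_self, Function.update_of_ne (hu_ne hw)] at huw
            exact absurd huw.symm (hnot ha w hw).1
          · rw [Function.update_self, Function.update_of_ne (hu_ne hu)] at huw
            exact absurd huw (hnot ha u hu).1
          · rw [Function.update_of_ne (hu_ne hu), Function.update_of_ne (hu_ne hw)] at huw
            exact hxy.injOn_left hu hw huw
        · intro u hu w hw huw
          rw [mem_coe, mem_insert] at hu hw
          rcases hu with rfl | hu <;> rcases hw with rfl | hw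
          · rfl
          · rw [Function.update_self, Function.update_of_ne (hu_ne hw)] at huw
            exact absurd huw.symm (hnot hb w hw).2
          · rw [Function.update_self, Function.update_of_ne (hu_ne hu)] at huw
            exact absurd huw (hnot hb u hu).2
          · rw [Function.update_of_ne (hu_ne hu), Function.update_of_ne (hu_ne hw)] at huw
            exact hxy.injOn_right hu hw huw
        · intro u hu
          rcases mem_insert.1 hu with rfl | hu
          · simpa using (mem_sdiff.1 ha).1
          · simpa [hu_ne hu] using hxy.left_mem u hu
        · intro u hu
          rcases mem_insert.1 hu with rfl | hu
          · simpa using (mem_sdiff.1 hb).1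
          · simpa [hu_ne hu] using hxy.right_mem u hu
        · intro u hu w hw
          rw [mem_insert] at hu hw
          rcases hu with rfl | hu <;> rcases hw with rfl | hw
          · rw [Function.update_self, Function.update_self]
            exact fun h' ↦ hab (congrArg h h').symm
          · rw [Function.update_self, Function.update_of_ne (hu_ne hw)]
            exact (hnot ha w hw).2.symm
          · rw [Function.update_self, Function.update_of_ne (hu_ne hu)]
            exact (hnot hb u hu).1
          · rw [Function.update_of_ne (hu_ne hu), Function.update_of_ne (hu_ne hw)]
            exact hxy.ne u hu w hw
        · intro u hu
          rcases mem_insert.1 hu with rfl | hu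
          · simpa using hab.symm
          · simpa [hu_ne hu] using hne u hu
    exact key J Subset.rfl

/-! ### Colourings whose rows differ by constants -/

/-- If any two rows of a colouring differ by a constant off at most `E` places, then these constants
are the differences of one function. -/
lemma exists_potential {W Γ : Type*} [AddCommGroup Γ] [DecidableEq Γ] {C : Sym2 W → Γ}
    {R : Finset W} {E : ℕ} (hR : 3 * E + 3 < #R)
    (hC : ∀ a ∈ R, ∀ b ∈ R, a ≠ b →
      ∃ κ, #{x ∈ R | x ≠ a ∧ x ≠ b ∧ C s(a, x) - C s(b, x) ≠ κ} ≤ E) :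
    ∃ h : W → Γ, ∀ a ∈ R, ∀ b ∈ R, a ≠ b →
      #{x ∈ R | x ≠ a ∧ x ≠ b ∧ C s(a, x) - C s(b, x) ≠ h a - h b} ≤ E := by
  obtain ⟨z, hz⟩ : R.Nonempty := card_pos.1 (by omega)
  have hh : ∀ a, ∃ κ, a ∈ R → #{x ∈ R | x ≠ a ∧ x ≠ z ∧ C s(a, x) - C s(z, x) ≠ κ} ≤ E := by
    intro a
    by_cases ha : a ∈ R
    · by_cases haz : a = z
      · subst haz
        exact ⟨0, fun _ ↦ by simp⟩
      · obtain ⟨κ, hκ⟩ := hC a ha z hz haz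
        exact ⟨κ, fun _ ↦ hκ⟩
    · exact ⟨0, fun h ↦ absurd h ha⟩
  choose h hh using hh
  refine ⟨h, fun a ha b hb hab ↦ ?_⟩
  obtain ⟨κ, hκ⟩ := hC a ha b hb hab
  have ha' := hh a ha
  have hb' := hh b hb
  suffices hκh : κ = h a - h b by rwa [hκh] at hκ
  set A := {x ∈ R | x ≠ a ∧ x ≠ b ∧ C s(a, x) - C s(b, x) ≠ κ} with hA
  set A₁ := {x ∈ R | x ≠ a ∧ x ≠ z ∧ C s(a, x) - C s(z, x) ≠ h a} with hA₁
  set A₂ := {x ∈ R | x ≠ b ∧ x ≠ z ∧ C s(b, x) - C s(z, x) ≠ h b} with hA₂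
  obtain ⟨x, hxR, hx⟩ : ∃ x ∈ R, x ∉ A ∪ A₁ ∪ A₂ ∪ {a, b, z} := by
    refine exists_mem_notMem_of_card_lt_card ?_
    have h1 := card_union_le (A ∪ A₁ ∪ A₂) {a, b, z}
    have h2 := card_union_le (A ∪ A₁) A₂
    have h3 := card_union_le A A₁
    have h4 : #{a, b, z} ≤ 3 := card_le_three
    omega
  simp only [mem_union, mem_insert, mem_singleton, not_or] at hx
  obtain ⟨⟨⟨hxA, hxA₁⟩, hxA₂⟩, hxa, hxb, hxz⟩ := hx
  have e1 : C s(a, x) - C s(b, x) = κ := by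
    by_contra hne
    exact hxA (mem_filter.2 ⟨hxR, hxa, hxb, hne⟩)
  have e2 : C s(a, x) - C s(z, x) = h a := by
    by_contra hne
    exact hxA₁ (mem_filter.2 ⟨hxR, hxa, hxz, hne⟩)
  have e3 : C s(b, x) - C s(z, x) = h b := by
    by_contra hne
    exact hxA₂ (mem_filter.2 ⟨hxR, hxb, hxz, hne⟩)
  rw [← e1, ← e2, ← e3]
  abel

/-- If any two rows of a colouring agree off at most `E` places, then the colouring is nearly
monochromatic off a set of at most `E` vertices. -/
lemma exists_isNearlyMono_of_rows_agree {W Γ : Type*} [DecidableEq Γ] {C : Sym2 W → Γ}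
    {R : Finset W} {E : ℕ} (hR : 2 ≤ #R)
    (hC : ∀ a ∈ R, ∀ b ∈ R, a ≠ b →
      #{x ∈ R | x ≠ a ∧ x ≠ b ∧ C s(a, x) ≠ C s(b, x)} ≤ E) :
    ∃ (α : Γ) (X : Finset W), #X ≤ E ∧ IsNearlyMono C α E (R \ X) := by
  obtain ⟨z, hz⟩ : R.Nonempty := card_pos.1 (by omega)
  -- Comparing all rows with the row of `z` and averaging over the columns gives a column, hence by
  -- symmetry a row, that is constant off `E` places.
  obtain ⟨x₀, hx₀, hX⟩ : ∃ x ∈ R.erase z,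
      #{a ∈ R.erase z | x ≠ a ∧ x ≠ z ∧ C s(a, x) ≠ C s(z, x)} ≤ E := by
    refine exists_le_of_sum_le (g := fun _ ↦ E) (card_pos.1 ?_) ?_
    · rw [card_erase_of_mem hz]
      omega
    · have := sum_card_bipartiteAbove_eq_sum_card_bipartiteBelow (s := R.erase z) (t := R.erase z)
        (fun x a ↦ x ≠ a ∧ x ≠ z ∧ C s(a, x) ≠ C s(z, x))
      simp only [bipartiteAbove, bipartiteBelow] at this
      rw [this]
      refine sum_le_sum fun a ha ↦ ?_
      rw [mem_erase] at ha
      exact (card_le_card (filter_subset_filter _ (erase_subset z R))).trans (hC a ha.2 z hz ha.1)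
  rw [mem_erase] at hx₀
  set X := {a ∈ R.erase z | x₀ ≠ a ∧ x₀ ≠ z ∧ C s(a, x₀) ≠ C s(z, x₀)} with hXdef
  have hrow (a : W) (ha : a ∈ R \ X) (hne : a ≠ x₀) : C s(a, x₀) = C s(z, x₀) := by
    by_cases haz : a = z
    · rw [haz]
    · by_contra hcon
      exact (mem_sdiff.1 ha).2 (mem_filter.2
        ⟨mem_erase.2 ⟨haz, (mem_sdiff.1 ha).1⟩, hne.symm, hx₀.1, hcon⟩)
  refine ⟨C s(z, x₀), X, hX, fun a ha ↦ ?_⟩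
  by_cases hax : a = x₀
  · rw [filter_false_of_mem, card_empty]
    · exact Nat.zero_le E
    · intro y hy hcon
      rw [hax, Sym2.eq_swap] at hcon
      exact hcon.2 (hrow y hy hcon.1)
  · refine (card_le_card fun y hy ↦ ?_).trans (hC a (mem_sdiff.1 ha).1 x₀ hx₀.2 hax)
    rw [mem_filter] at hy ⊢
    have hyx : y ≠ x₀ := by
      rintro rfl
      exact hy.2.2 (hrow a ha hax)
    refine ⟨(mem_sdiff.1 hy.1).1, hy.2.1, hyx, ?_⟩
    rw [Sym2.eq_swap (a := x₀), hrow y hy.1 hyx]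
    exact hy.2.2

/-! ### Finding switches -/

/-- If `D v`, for `v ∈ J`, takes a nonzero value `κ v` off at most `E` elements of `M`, then some
injective placement of the vertices of `G` in `M` puts all neighbours of `v` where `D v` is `κ v`,
for many `v ∈ J`. The average over the cyclic shifts of one placement shows this. -/
lemma exists_placement_avoiding {V W : Type*} [Fintype V] (G : SimpleGraph V) {d E k : ℕ}
    (J : Finset V) (M : Finset W) (B : V → Finset W) (hM : 0 < #M) (hVM : Fintype.card V ≤ #M)
    (hdeg : ∀ v ∈ J, G.degree v ≤ 2 * d) (hB : ∀ v ∈ J, #(B v) ≤ E)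
    (hcard : #J * (2 * d * E) ≤ k * #M) :
    ∃ ψ : V → W, Function.Injective ψ ∧ (∀ v, ψ v ∈ M) ∧
      #J ≤ #{v ∈ J | ∀ w ∈ G.neighborFinset v, ψ w ∉ B v} + k := by
  set N := #M with hN
  have : NeZero N := ⟨hM.ne'⟩
  obtain ⟨ψ₀⟩ : Nonempty (V ↪ M) := Function.Embedding.nonempty_of_card_le (by simpa using hVM)
  have σ : M ≃ ZMod N := Fintype.equivOfCardEq (by simp [hN])
  let ψ (s : ZMod N) (w : V) : M := σ.symm (σ (ψ₀ w) + s)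
  have hψ (s) : Function.Injective (ψ s) := by
    intro u w h
    have := σ.symm.injective h
    exact ψ₀.injective (σ.injective (add_right_cancel this))
  have hhit (w : V) (A : Finset W) : #{s | (ψ s w : W) ∈ A} ≤ #A := by
    refine card_le_card_of_injOn (fun s ↦ (ψ s w : W)) (fun s hs ↦ ?_) ?_
    · simpa using hs
    · intro s _ s' _ h
      exact add_left_cancel (σ.symm.injective (Subtype.ext h))
  obtain ⟨s, -, hs⟩ : ∃ s ∈ (univ : Finset (ZMod N)),
      ∑ v ∈ J, ∑ w ∈ G.neighborFinset v, (if (ψ s w : W) ∈ B v then 1 else 0) ≤ k := by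
    refine exists_le_of_sum_le univ_nonempty ?_
    rw [sum_const, card_univ, ZMod.card, smul_eq_mul, mul_comm N, sum_comm]
    refine le_trans ?_ hcard
    rw [← smul_eq_mul]
    refine sum_le_card_nsmul _ _ _ fun v hv ↦ ?_
    rw [sum_comm]
    calc ∑ w ∈ G.neighborFinset v, ∑ s, (if (ψ s w : W) ∈ B v then 1 else 0)
        ≤ ∑ w ∈ G.neighborFinset v, E := by
          refine sum_le_sum fun w _ ↦ ?_
          rw [← card_filter]
          exact (hhit w (B v)).trans (hB v hv)
      _ = G.degree v * E := by rw [sum_const, G.card_neighborFinset_eq_degree, smul_eq_mul]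
      _ ≤ 2 * d * E := Nat.mul_le_mul_right E (hdeg v hv)
  refine ⟨fun w ↦ ψ s w, Subtype.val_injective.comp (hψ s), fun v ↦ (ψ s v).2, ?_⟩
  rw [← card_filter_add_card_filter_not (s := J)
    (fun v ↦ ∀ w ∈ G.neighborFinset v, (ψ s w : W) ∉ B v)]
  refine Nat.add_le_add_left (le_trans ?_ hs) _
  rw [card_filter]
  refine sum_le_sum fun v _ ↦ ?_
  split_ifs with h
  · exact Nat.zero_le _
  · push Not at h
    obtain ⟨w, hw, hwB⟩ := h
    refine le_trans ?_ (single_le_sum (fun _ _ ↦ Nat.zero_le _) hw)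
    rw [if_pos hwB]

/-- Pairs of places whose rows differ by a nonzero constant off few elements give switches. -/
lemma hasSwitches_of_rows_ne {V W : Type*} [Fintype V] {G : SimpleGraph V} {p d E k : ℕ}
    {C : Sym2 W → ZMod p} {I J : Finset V} {R : Finset W} {x y : V → W} {κ : V → ZMod p}
    (hp : p.Prime) (hdp : 2 * d < p) (hI : ∀ u ∈ I, ∀ v ∈ I, ¬ G.Adj u v)
    (hdeg : ∀ v ∈ I, 1 ≤ G.degree v ∧ G.degree v ≤ 2 * d) (hJI : J ⊆ I) (hJ : #J = 2 * k)
    (hxy : IsDisjointPairs J R x y) (hR : 4 * k < #R) (hVR : Fintype.card V + 4 * k ≤ #R)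
    (hcard : 2 * (2 * d * E) + 4 * k ≤ #R) (hκ : ∀ v ∈ J, κ v ≠ 0)
    (hrow : ∀ v ∈ J,
      #{a ∈ R | a ≠ x v ∧ a ≠ y v ∧ C s(x v, a) - C s(y v, a) ≠ κ v} ≤ E) :
    HasSwitches G C k I R := by
  have : Fact p.Prime := ⟨hp⟩
  have hU := hxy.card_union
  have hUR := hxy.union_subset
  set U := J.image x ∪ J.image y with hUdef
  have hM : #(R \ U) = #R - 4 * k := by
    rw [card_sdiff_of_subset hUR, hU, hJ]
    omega
  obtain ⟨ψ, hψ, hψM, hgood⟩ := exists_placement_avoiding G (d := d) (E := E) (k := k) J (R \ U)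
    (fun v ↦ {a ∈ R | a ≠ x v ∧ a ≠ y v ∧ C s(x v, a) - C s(y v, a) ≠ κ v})
    (by omega) (by omega) (fun v hv ↦ (hdeg v (hJI hv)).2) hrow (by
      rw [hM, hJ, mul_comm 2 k, mul_assoc]
      exact Nat.mul_le_mul_left k (by omega))
  set J' := {v ∈ J | ∀ w ∈ G.neighborFinset v,
    ψ w ∉ ({a ∈ R | a ≠ x v ∧ a ≠ y v ∧ C s(x v, a) - C s(y v, a) ≠ κ v} : Finset W)} with hJ'
  have hJ'J : J' ⊆ J := filter_subset _ _
  have hψx (w) (v) (hv : v ∈ J) : ψ w ≠ x v := fun h ↦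
    (mem_sdiff.1 (hψM w)).2 (h ▸ mem_union_left _ (mem_image_of_mem x hv))
  have hψy (w) (v) (hv : v ∈ J) : ψ w ≠ y v := fun h ↦
    (mem_sdiff.1 (hψM w)).2 (h ▸ mem_union_right _ (mem_image_of_mem y hv))
  refine ⟨fun w ↦ if w ∈ J then x w else ψ w, y, J', ?_, ?_, hJ'J.trans hJI, by omega,
    hxy.injOn_right.mono (by exact_mod_cast hJ'J), ?_, ?_⟩
  · intro u w huw
    dsimp only at huw
    split_ifs at huw with hu hw hw
    · exact hxy.injOn_left hu hw huw
    · exact absurd huw.symm (hψx w u hu)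
    · exact absurd huw (hψx u w hw)
    · exact hψ huw
  · intro v
    dsimp only
    split_ifs with hv
    · exact hxy.left_mem v hv
    · exact (mem_sdiff.1 (hψM v)).1
  · refine fun v hv ↦ ⟨hxy.right_mem v (hJ'J hv), fun w ↦ ?_⟩
    dsimp only
    split_ifs with hw
    · exact hxy.ne w hw v (hJ'J hv)
    · exact hψy w v (hJ'J hv)
  · intro v hv
    have hvJ := hJ'J hv
    have hterm : ∀ w ∈ G.neighborFinset v,
        C s(if w ∈ J then x w else ψ w, if v ∈ J then x v else ψ v) -
          C s(if w ∈ J then x w else ψ w, y v) = κ v := by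
      intro w hw
      have hwJ : w ∉ J := fun h ↦
        hI v (hJI hvJ) w (hJI h) ((G.mem_neighborFinset v w).1 hw)
      rw [if_neg hwJ, if_pos hvJ, Sym2.eq_swap (b := x v), Sym2.eq_swap (b := y v)]
      by_contra hne
      exact (mem_filter.1 hv).2 w hw (mem_filter.2
        ⟨(mem_sdiff.1 (hψM w)).1, hψx w v hvJ, hψy w v hvJ, hne⟩)
    rw [sum_congr rfl hterm, sum_const, G.card_neighborFinset_eq_degree, nsmul_eq_mul]
    refine mul_ne_zero ?_ (hκ v hvJ)
    rw [Ne, ZMod.natCast_eq_zero_iff]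
    obtain ⟨h1, h2⟩ := hdeg v (hJI hvJ)
    exact fun h ↦ absurd (Nat.le_of_dvd h1 h) (by omega)

/-- A vertex `t` with the two options `a` and `b`, and `2q - 1` neighbours of `t` whose pairs of
options separate the difference of the rows of `a` and `b`, add `q` switches to those at vertices
not adjacent to `t`: at each of the neighbours, one of the two options for `t` makes a switch. -/
lemma HasSwitches.extend {V W : Type*} [Fintype V] {Γ : Type*} [AddCommGroup Γ]
    {G : SimpleGraph V} {k q : ℕ} {C : Sym2 W → Γ} {I J : Finset V} {R : Finset W}
    {x y : V → W} {t : V} {a b : W} (hI : ∀ u ∈ I, ∀ v ∈ I, ¬ G.Adj u v) (hJI : J ⊆ I)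
    (htJ : ∀ v ∈ J, G.Adj t v) (hJ : #J = 2 * q - 1) (hq : 1 ≤ q) (ha : a ∈ R) (hb : b ∈ R)
    (hxy : IsDisjointPairs J ((R.erase a).erase b) x y)
    (hne : ∀ v ∈ J, C s(a, x v) - C s(b, x v) ≠ C s(a, y v) - C s(b, y v))
    (h : HasSwitches G C k {v ∈ I | ¬ G.Adj t v}
      (((R.erase a).erase b) \ (J.image x ∪ J.image y))) :
    HasSwitches G C (k + q) I R := by
  obtain ⟨φ, z, J', hφ, hφR, hJ'I, hJ', hz, hzR, hΔ⟩ := h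
  simp only [mem_sdiff, mem_erase, mem_union, mem_image, not_or, not_exists, not_and] at hφR hzR
  have hJ'mem (v) (hv : v ∈ J') : v ∈ I ∧ ¬ G.Adj t v := by simpa using hJ'I hv
  have hxm (v) (hv : v ∈ J) : x v ≠ b ∧ x v ≠ a ∧ x v ∈ R := by simpa using hxy.left_mem v hv
  have hym (v) (hv : v ∈ J) : y v ≠ b ∧ y v ≠ a ∧ y v ∈ R := by simpa using hxy.right_mem v hv
  obtain ⟨v₀, hv₀⟩ : J.Nonempty := card_pos.1 (by omega)
  have htI : t ∉ I := fun ht ↦ hI t ht v₀ (hJI hv₀) (htJ v₀ hv₀)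
  have htJ' : t ∉ J := fun ht ↦ htI (hJI ht)
  have hdisj : ∀ v ∈ J', v ∉ J := fun v hv hvJ ↦ (hJ'mem v hv).2 (htJ v hvJ)
  -- the embedding with `t` placed at `s`
  let F (s : W) (w : V) : W := if w = t then s else if w ∈ J then x w else φ w
  have hFt (s) : F s t = s := if_pos rfl
  have hFJ (s) (v) (hv : v ∈ J) : F s v = x v := by
    have : v ≠ t := fun h ↦ htJ' (h ▸ hv)
    simp [F, this, hv]
  have hFφ (s) (w) (hw : w ≠ t) (hwJ : w ∉ J) : F s w = φ w := by simp [F, hw, hwJ]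
  let Δ (s : W) (v : V) : Γ := ∑ w ∈ G.neighborFinset v, (C s(F s w, x v) - C s(F s w, y v))
  have hΔne : ∀ v ∈ J, Δ a v ≠ 0 ∨ Δ b v ≠ 0 := by
    intro v hv
    by_contra! hcon
    have htN : t ∈ G.neighborFinset v := by simpa using (htJ v hv).symm
    have hrest : ∑ w ∈ (G.neighborFinset v).erase t, (C s(F a w, x v) - C s(F a w, y v)) =
        ∑ w ∈ (G.neighborFinset v).erase t, (C s(F b w, x v) - C s(F b w, y v)) := by
      refine sum_congr rfl fun w hw ↦ ?_
      have : F a w = F b w := by simp [F, (mem_erase.1 hw).1]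
      rw [this]
    obtain ⟨h1, h2⟩ := hcon
    simp only [Δ] at h1 h2
    rw [← add_sum_erase _ _ htN, hFt] at h1 h2
    rw [hrest, ← h2] at h1
    have := add_right_cancel h1
    refine hne v hv ?_
    rw [sub_eq_sub_iff_add_eq_add] at this ⊢
    rw [add_comm (C s(a, y v)), this.symm, add_comm]
  obtain ⟨s, hs, hq'⟩ : ∃ s, (s = a ∨ s = b) ∧ q ≤ #{v ∈ J | Δ s v ≠ 0} := by
    by_contra! hcon
    have h1 := hcon a (Or.inl rfl)
    have h2 := hcon b (Or.inr rfl)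
    have h3 : J ⊆ {v ∈ J | Δ a v ≠ 0} ∪ {v ∈ J | Δ b v ≠ 0} := fun v hv ↦ by
      rw [mem_union, mem_filter, mem_filter]
      exact (hΔne v hv).imp (fun h ↦ ⟨hv, h⟩) fun h ↦ ⟨hv, h⟩
    have h4 := (card_le_card h3).trans (card_union_le _ _)
    omega
  set K := {v ∈ J | Δ s v ≠ 0} with hK
  have hKJ : K ⊆ J := filter_subset _ _
  have hsR : s ∈ R := by rcases hs with rfl | rfl <;> assumption
  have hxs (v) (hv : v ∈ J) : x v ≠ s := by
    rcases hs with rfl | rfl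
    exacts [(hxm v hv).2.1, (hxm v hv).1]
  have hys (v) (hv : v ∈ J) : y v ≠ s := by
    rcases hs with rfl | rfl
    exacts [(hym v hv).2.1, (hym v hv).1]
  have hφs (v) : φ v ≠ s := by
    rcases hs with rfl | rfl
    exacts [(hφR v).1.2.1, (hφR v).1.1]
  have hzs (v) (hv : v ∈ J') : z v ≠ s := by
    rcases hs with rfl | rfl
    exacts [(hzR v hv).1.1.2.1, (hzR v hv).1.1.1]
  have hcase (w : V) : w = t ∨ w ∈ J ∨ (w ≠ t ∧ w ∉ J) := by tauto
  refine ⟨F s, fun v ↦ if v ∈ J then y v else z v, J' ∪ K, ?_, ?_, ?_, ?_, ?_, ?_, ?_⟩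
  · intro u w huw
    rcases hcase u with rfl | hu | hu <;> rcases hcase w with rfl | hw | hw
    · rfl
    · rw [hFt, hFJ s w hw] at huw
      exact absurd huw.symm (hxs w hw)
    · rw [hFt, hFφ s w hw.1 hw.2] at huw
      exact absurd huw.symm (hφs w)
    · rw [hFt, hFJ s u hu] at huw
      exact absurd huw (hxs u hu)
    · rw [hFJ s u hu, hFJ s w hw] at huw
      exact hxy.injOn_left hu hw huw
    · rw [hFJ s u hu, hFφ s w hw.1 hw.2] at huw
      exact absurd huw ((hφR w).2.1 u hu)
    · rw [hFt, hFφ s u hu.1 hu.2] at huw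
      exact absurd huw (hφs u)
    · rw [hFJ s w hw, hFφ s u hu.1 hu.2] at huw
      exact absurd huw.symm ((hφR u).2.1 w hw)
    · rw [hFφ s u hu.1 hu.2, hFφ s w hw.1 hw.2] at huw
      exact hφ huw
  · intro v
    rcases hcase v with rfl | hv | hv
    · rwa [hFt]
    · rw [hFJ s v hv]
      exact (hxm v hv).2.2
    · rw [hFφ s v hv.1 hv.2]
      exact (hφR v).1.2.2
  · exact union_subset (fun v hv ↦ (hJ'mem v hv).1) (hKJ.trans hJI)
  · rw [card_union_of_disjoint]
    · omega
    · exact disjoint_left.2 fun v hv hvK ↦ hdisj v hv (hKJ hvK)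
  · intro u hu w hw huw
    rw [mem_coe, mem_union] at hu hw
    dsimp only at huw
    rcases hu with hu | hu <;> rcases hw with hw | hw
    · rw [if_neg (hdisj u hu), if_neg (hdisj w hw)] at huw
      exact hz hu hw huw
    · rw [if_neg (hdisj u hu), if_pos (hKJ hw)] at huw
      exact absurd huw.symm ((hzR u hu).1.2.2 w (hKJ hw))
    · rw [if_neg (hdisj w hw), if_pos (hKJ hu)] at huw
      exact absurd huw ((hzR w hw).1.2.2 u (hKJ hu))
    · rw [if_pos (hKJ hu), if_pos (hKJ hw)] at huw
      exact hxy.injOn_right (hKJ hu) (hKJ hw) huw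
  · intro v hv
    dsimp only
    rw [mem_union] at hv
    rcases hv with hv | hv
    · rw [if_neg (hdisj v hv)]
      refine ⟨(hzR v hv).1.1.2.2, fun w ↦ ?_⟩
      rcases hcase w with rfl | hw | hw
      · rw [hFt]
        exact (hzs v hv).symm
      · rw [hFJ s w hw]
        exact (hzR v hv).1.2.1 w hw
      · rw [hFφ s w hw.1 hw.2]
        exact (hzR v hv).2 w
    · have hvJ := hKJ hv
      rw [if_pos hvJ]
      refine ⟨(hym v hvJ).2.2, fun w ↦ ?_⟩
      rcases hcase w with rfl | hw | hw
      · rw [hFt]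
        exact (hys v hvJ).symm
      · rw [hFJ s w hw]
        exact hxy.ne w hw v hvJ
      · rw [hFφ s w hw.1 hw.2]
        exact fun h ↦ (hφR w).2.2 v hvJ h.symm
  · intro v hv
    dsimp only
    rw [mem_union] at hv
    rcases hv with hv | hv
    · obtain ⟨hvI, htv⟩ := hJ'mem v hv
      have hvt : v ≠ t := fun h ↦ htI (h ▸ hvI)
      have heq : ∀ w ∈ G.neighborFinset v, F s w = φ w := by
        intro w hw
        rw [G.mem_neighborFinset] at hw
        refine hFφ s w ?_ fun h ↦ hI v hvI w (hJI h) hw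
        rintro rfl
        exact htv hw.symm
      rw [if_neg (hdisj v hv), hFφ s v hvt (hdisj v hv),
        sum_congr rfl fun w hw ↦ by rw [heq w hw]]
      exact hΔ v hv
    · rw [if_pos (hKJ hv), hFJ s v (hKJ hv)]
      exact (mem_filter.1 hv).2

/-- When any two rows of the colouring differ by a constant off `2k - 2` places, `2k` vertices of
low degree give `k` switches, unless the colouring is nearly monochromatic. -/
lemma hasSwitches_or_isNearlyMono_of_rows {V W : Type*} [Fintype V] [Nonempty W]
    {G : SimpleGraph V} {p d k : ℕ} {C : Sym2 W → ZMod p} {I : Finset V} {R : Finset W}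
    (hp : p.Prime) (hdp : 2 * d < p) (hk : 1 ≤ k) (hI : ∀ u ∈ I, ∀ v ∈ I, ¬ G.Adj u v)
    (hdeg : ∀ v ∈ I, 1 ≤ G.degree v ∧ G.degree v ≤ 2 * d) (hIk : 2 * k ≤ #I)
    (hR₁ : 6 * k < #R) (hR₂ : Fintype.card V + 4 * k ≤ #R)
    (hR₃ : 2 * (2 * d * (2 * k - 2)) + 4 * k ≤ #R)
    (hR₄ : Fintype.card V + d * (2 * k - 2) + 4 * k ≤ #R + 2)
    (hC : ∀ a ∈ R, ∀ b ∈ R, a ≠ b →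
      ∃ κ, #{x ∈ R | x ≠ a ∧ x ≠ b ∧ C s(a, x) - C s(b, x) ≠ κ} ≤ 2 * k - 2) :
    HasSwitches G C k I R ∨
      ∃ (α : ZMod p) (D : ℕ) (R' : Finset W),
        IsNearlyMono C α D R' ∧ Fintype.card V + d * D ≤ #R' := by
  obtain ⟨h, hh⟩ := exists_potential (R := R) (E := 2 * k - 2) (by omega) hC
  obtain ⟨J, hJI, hJ⟩ := exists_subset_card_eq hIk
  rcases exists_isDisjointPairs_or_card_lt J R h (by omega) with ⟨x, y, hxy, hne⟩ | ⟨η, hη⟩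
  · left
    exact hasSwitches_of_rows_ne (κ := fun v ↦ h (x v) - h (y v)) hp hdp hI hdeg hJI hJ hxy
      (by omega) hR₂ hR₃ (fun v hv ↦ sub_ne_zero.2 (hne v hv)) fun v hv ↦
        hh _ (hxy.left_mem v hv) _ (hxy.right_mem v hv) (hxy.ne v hv v hv)
  · right
    set R₁ := {a ∈ R | h a = η} with hR₁def
    have hR₁R : R₁ ⊆ R := filter_subset _ _
    have hR₁card : #R₁ + #{a ∈ R | h a ≠ η} = #R := card_filter_add_card_filter_not _
    obtain ⟨α, X, hX, hmono⟩ := exists_isNearlyMono_of_rows_agree (C := C) (R := R₁)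
      (E := 2 * k - 2) (by omega) (by
        intro a ha b hb hab
        refine (card_le_card fun x hx ↦ ?_).trans (hh a (hR₁R ha) b (hR₁R hb) hab)
        rw [mem_filter] at hx ⊢
        rw [(mem_filter.1 ha).2, (mem_filter.1 hb).2, sub_self, sub_ne_zero]
        exact ⟨hR₁R hx.1, hx.2⟩)
    have := le_card_sdiff X R₁
    exact ⟨α, 2 * k - 2, R₁ \ X, hmono, by omega⟩

/-- Either the colouring of a large set has `k` switches at vertices of `I`, or it is nearly
monochromatic. The induction removes a hub `t`, a vertex adjacent to `s ≥ 1` vertices of `I`: if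
the rows of two vertices of `R` differ by a function separating about `s` pairs, these vertices
serve as options for `t`, at a cost of `4` vertices of `R` and at most `2` vertices of `I` for each
switch. -/
lemma hasSwitches_or_isNearlyMono {V W : Type*} [Fintype V] [Nonempty W] {G : SimpleGraph V}
    {p d : ℕ} {C : Sym2 W → ZMod p} (hp : p.Prime) (hd : 1 ≤ d) (hdp : 2 * d < p)
    (hV : 2 * (d + 1) ^ 2 * p ≤ Fintype.card V) (k : ℕ) (hk : k ≤ p - 1) (I : Finset V)
    (R : Finset W) (hI : ∀ u ∈ I, ∀ v ∈ I, ¬ G.Adj u v)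
    (hdeg : ∀ v ∈ I, 1 ≤ G.degree v ∧ G.degree v ≤ 2 * d) (hIk : 2 * k ≤ #I)
    (hR : Fintype.card V + (3 + 3 * d) * p ≤ #R + 4 * (p - 1 - k)) :
    HasSwitches G C k I R ∨
      ∃ (α : ZMod p) (D : ℕ) (R' : Finset W),
        IsNearlyMono C α D R' ∧ Fintype.card V + d * D ≤ #R' := by
  induction k using Nat.strong_induction_on generalizing I R with
  | _ k ih =>
  have hdp1 : p ≤ d * p := Nat.le_mul_of_pos_left p hd
  have hexp : (3 + 3 * d) * p = 3 * p + 3 * (d * p) := by ring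
  rw [hexp] at hR
  rcases Nat.eq_zero_or_pos k with rfl | hk0
  · left
    obtain ⟨φ, hφ, hφR⟩ := exists_injOn_of_card_le (J := (univ : Finset V)) (A := R)
      (by rw [card_univ]; omega)
    exact ⟨φ, φ, ∅, fun u v h ↦ hφ (mem_coe.2 (mem_univ u)) (mem_coe.2 (mem_univ v)) h,
      fun v ↦ hφR v (mem_univ v), empty_subset I, le_rfl, by simp, by simp, by simp⟩
  have hdk : d * k ≤ d * p := Nat.mul_le_mul_left d (by omega)
  have hV' : 2 * (d * (d * p)) + 4 * (d * p) + 2 * p ≤ Fintype.card V :=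
    le_trans (le_of_eq (by ring)) hV
  obtain ⟨v₀, hv₀⟩ : I.Nonempty := card_pos.1 (by omega)
  obtain ⟨t, ht⟩ : (G.neighborFinset v₀).Nonempty := by
    rw [← card_pos, G.card_neighborFinset_eq_degree]
    exact (hdeg v₀ hv₀).1
  rw [G.mem_neighborFinset] at ht
  have hsplit : #{v ∈ I | G.Adj t v} + #{v ∈ I | ¬ G.Adj t v} = #I :=
    card_filter_add_card_filter_not _
  have hs : 0 < #{v ∈ I | G.Adj t v} := card_pos.2 ⟨v₀, mem_filter.2 ⟨hv₀, ht.symm⟩⟩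
  -- `q` switches are wanted from the hub; an odd number of its neighbours suffices for them.
  obtain ⟨q, hq1, hqk, hqs, hq⟩ : ∃ q, 1 ≤ q ∧ q ≤ k ∧ 2 * q - 1 ≤ #{v ∈ I | G.Adj t v} ∧
      2 * (k - q) ≤ #{v ∈ I | ¬ G.Adj t v} :=
    ⟨min k ((#{v ∈ I | G.Adj t v} + 1) / 2), by omega, by omega, by omega, by omega⟩
  obtain ⟨J, hJt, hJ⟩ := exists_subset_card_eq hqs
  by_cases hpairs : ∃ a ∈ R, ∃ b ∈ R, a ≠ b ∧ ∃ x y : V → W,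
      IsDisjointPairs J ((R.erase a).erase b) x y ∧
        ∀ v ∈ J, C s(a, x v) - C s(b, x v) ≠ C s(a, y v) - C s(b, y v)
  · obtain ⟨a, ha, b, hb, hab, x, y, hxy, hne⟩ := hpairs
    have hcard : #(((R.erase a).erase b) \ (J.image x ∪ J.image y)) = #R - 4 * q := by
      rw [card_sdiff_of_subset hxy.union_subset, hxy.card_union, hJ,
        card_erase_of_mem (mem_erase.2 ⟨hab.symm, hb⟩), card_erase_of_mem ha]
      omega
    refine (ih (k - q) (by omega) (by omega) {v ∈ I | ¬ G.Adj t v}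
      (((R.erase a).erase b) \ (J.image x ∪ J.image y))
      (fun u hu v hv ↦ hI u (mem_filter.1 hu).1 v (mem_filter.1 hv).1)
      (fun v hv ↦ hdeg v (mem_filter.1 hv).1) hq (by omega)).imp (fun h ↦ ?_) id
    have := h.extend hI (hJt.trans (filter_subset _ _)) (fun v hv ↦ (mem_filter.1 (hJt hv)).2)
      hJ hq1 ha hb hxy hne
    rwa [Nat.sub_add_cancel hqk] at this
  · refine hasSwitches_or_isNearlyMono_of_rows hp hdp hk0 hI hdeg hIk ?_ ?_ ?_ ?_ ?_
    · omega
    · omega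
    · have h1 : 2 * (2 * d * (2 * k - 2)) ≤ 8 * (d * k) := by
        calc 2 * (2 * d * (2 * k - 2)) ≤ 2 * (2 * d * (2 * k)) := by gcongr; omega
          _ = 8 * (d * k) := by ring
      have h2 : d * p ≤ d * (d * p) := Nat.le_mul_of_pos_left _ hd
      omega
    · have h1 : d * (2 * k - 2) ≤ 2 * (d * k) := by
        calc d * (2 * k - 2) ≤ d * (2 * k) := by gcongr; omega
          _ = 2 * (d * k) := by ring
      omega
    · intro a ha b hb hab
      have hMcard : #((R.erase a).erase b) = #R - 2 := by
        rw [card_erase_of_mem (mem_erase.2 ⟨hab.symm, hb⟩), card_erase_of_mem ha]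
        omega
      rcases exists_isDisjointPairs_or_card_lt J ((R.erase a).erase b)
        (fun x ↦ C s(a, x) - C s(b, x)) (by omega) with ⟨x, y, hxy, hne⟩ | ⟨κ, hκ⟩
      · exact absurd ⟨a, ha, b, hb, hab, x, y, hxy, hne⟩ hpairs
      · have hκ' : #{x ∈ (R.erase a).erase b | C s(a, x) - C s(b, x) ≠ κ} ≤ 2 * k - 2 := by omega
        refine ⟨κ, (card_le_card fun x hx ↦ ?_).trans hκ'⟩
        rw [mem_filter] at hx
        exact mem_filter.2 ⟨mem_erase.2 ⟨hx.2.2.1, mem_erase.2 ⟨hx.2.1, hx.1⟩⟩, hx.2.2.2⟩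

/-! ### Zero-sum copies -/

/-- The statement on zero-sum copies for colourings given as functions on unordered pairs. -/
lemma IsDegenerate.exists_sum_eq_zero {V W : Type*} [Fintype V] [Fintype W] {G : SimpleGraph V}
    {d p : ℕ} (hG : IsDegenerate G d) (hp : p.Prime) (hpm : p ∣ #G.edgeFinset) (hdp : 2 * d < p)
    (hle : p * (2 * d * (d + 1) ^ 2) ≤ #G.edgeFinset)
    (hW : Fintype.card V + (3 + 3 * d) * p ≤ Fintype.card W) (C : Sym2 W → ZMod p) :
    ∃ φ : V → W, Function.Injective φ ∧ ∑ e ∈ G.edgeFinset, C (e.map φ) = 0 := by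
  have hW0 : 0 < Fintype.card W := by
    have : 0 < (3 + 3 * d) * p := Nat.mul_pos (by omega) hp.pos
    omega
  have : Nonempty W := Fintype.card_pos_iff.1 hW0
  have hmono : (∃ (α : ZMod p) (D : ℕ) (R : Finset W),
      IsNearlyMono C α D R ∧ Fintype.card V + d * D ≤ #R) →
      ∃ φ : V → W, Function.Injective φ ∧ ∑ e ∈ G.edgeFinset, C (e.map φ) = 0 := by
    rintro ⟨α, D, R, hR, hcard⟩
    obtain ⟨φ, hφ, hC⟩ := hG.exists_mono_of_isNearlyMono hR hcard
    refine ⟨φ, hφ, ?_⟩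
    rw [sum_congr rfl (g := fun _ ↦ α), sum_const, nsmul_eq_mul,
      (ZMod.natCast_eq_zero_iff _ _).2 hpm, zero_mul]
    intro e he
    induction e using Sym2.ind with
    | _ u v => exact hC u v (by simpa using he)
  rcases Nat.eq_zero_or_pos d with rfl | hd
  · -- every set is nearly monochromatic if arbitrarily many deviating edges are allowed
    refine hmono ⟨0, Fintype.card W, univ, fun x _ ↦ card_le_univ _, ?_⟩
    rw [card_univ]
    omega
  obtain ⟨I, hI, hdeg, hIcard⟩ := hG.exists_indep
  have hdpos : 0 < d * (d + 1) ^ 2 := by positivity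
  have hI2 : 2 * p ≤ #I := by
    refine Nat.le_of_mul_le_mul_left ?_ hdpos
    calc d * (d + 1) ^ 2 * (2 * p) = p * (2 * d * (d + 1) ^ 2) := by ring
      _ ≤ _ := hle.trans hIcard
  have hV : 2 * (d + 1) ^ 2 * p ≤ Fintype.card V := by
    refine Nat.le_of_mul_le_mul_left ?_ hd
    calc d * (2 * (d + 1) ^ 2 * p) = p * (2 * d * (d + 1) ^ 2) := by ring
      _ ≤ #G.edgeFinset := hle
      _ ≤ d * #{v | G.degree v ≠ 0} := hG.card_edgeFinset_le
      _ ≤ d * Fintype.card V := Nat.mul_le_mul_left d (card_le_univ _)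
  rcases hasSwitches_or_isNearlyMono (C := C) hp hd hdp hV (p - 1) le_rfl I univ hI hdeg
    (by omega) (by rw [card_univ]; omega) with h | h
  · exact h.exists_sum_eq_zero hp hI
  · exact hmono h

end Auxiliary

end ZeroSumRamsey

theorem theorem1 {V : Type*} [Fintype V] (G : SimpleGraph V) [Fintype G.edgeSet]
    (d n m p : ℕ) (hG : ZeroSumRamsey.IsDegenerate G d)
    (hn : Fintype.card V = n) (hm : Fintype.card G.edgeSet = m)
    (hp : p.Prime) (hpm : p ∣ m) (hdp : 2 * d < p)
    (hle : p * (2 * d * (d + 1) ^ 2) ≤ m) :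
    ZeroSumRamsey.ramseyNumber G (ZMod p) ≤ ((n + (3 + 3 * d) * p : ℕ) : ℕ∞) ∧
      ZeroSumRamsey.Arrows G (ZMod p) (n + (3 + 3 * d) * p) := by
  have harrows : ZeroSumRamsey.Arrows G (ZMod p) (n + (3 + 3 * d) * p) := by
    classical
    intro c
    -- the colouring extended to all unordered pairs, with the value `0` on the diagonal
    let C (e : Sym2 (Fin (n + (3 + 3 * d) * p))) : ZMod p :=
      if h : e ∈ (⊤ : SimpleGraph (Fin (n + (3 + 3 * d) * p))).edgeSet then c ⟨e, h⟩ else 0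
    have hcard : G.edgeFinset.card = m := by
      rw [← hm, SimpleGraph.edgeFinset_card]
    obtain ⟨φ, hφ, hsum⟩ := hG.exists_sum_eq_zero (C := C) hp
      (by convert hpm; convert hcard) hdp (by convert hle; convert hcard)
      (by rw [Fintype.card_fin, hn])
    let f : SimpleGraph.Copy G (⊤ : SimpleGraph (Fin (n + (3 + 3 * d) * p))) :=
      ⟨⟨φ, fun h ↦ hφ.ne h.ne⟩, hφ⟩
    refine ⟨f, ?_⟩
    have hC (e : G.edgeSet) : c (f.toHom.mapEdgeSet e) = C ((e : Sym2 V).map φ) := by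
      have he : (e : Sym2 V).map φ ∈
          (⊤ : SimpleGraph (Fin (n + (3 + 3 * d) * p))).edgeSet :=
        (f.toHom.mapEdgeSet e).2
      simp only [C, dif_pos he]
      rfl
    unfold ZeroSumRamsey.IsZeroSum
    rw [Fintype.sum_congr _ _ hC, ← hsum]
    convert (Finset.sum_subtype _ (fun _ ↦ SimpleGraph.mem_edgeFinset)
      fun e : Sym2 V ↦ C (e.map φ)).symm
  exact ⟨iInf₂_le _ harrows, harrows⟩
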